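/- Let $\mathbb F$ be a field of characteristic zero, let $1\le n\le m$, and let $\mathbb F(\mathbf x)=\mathbb F(x_1,\dots,x_m)$ be the field of rational functions. For each $i$ let $\sigma_{x_i}$ be the $\mathbb F$-automorphism of $\mathbb F(\mathbf x)$ with $\sigma_{x_i}(x_i)=x_i+1$ and $\sigma_{x_i}(x_k)=x_k$ for $k\ne i$, and put $\Delta_\tau(g)=\tau(g)-g$ for an automorphism $\tau$. Let $G=\langle\sigma_{x_1},\dots,\sigma_{x_n}\rangle$, and write $\hat{\mathbf x}_1=(x_2,\dots,x_m)$. Let $f=a/d^j$, where $j\ge 1$, $d\in\mathbb F[\mathbf x]$ is irreducible, and $a\in\mathbb F(\hat{\mathbf x}_1)[x_1]$ with $\deg_{x_1}a<\deg_{x_1}d$ (with $\deg_{x_1}0=-\infty$). Let $\tau_1,\dots,\tau_r$ be a basis of the free abelian group $G_d=\{\tau\in G\mid\tau(d)=d\}$ (with $r=0$ if $G_d$ is trivial). Then $f$ is $(\sigma_{x_1},\dots,\sigma_{x_n})$-summable, i.e. $f=\Delta_{\sigma_{x_1}}(g_1)+\cdots+\Delta_{\sigma_{x_n}}(g_n)$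 for some $g_1,\dots,g_n\in\mathbb F(\mathbf x)$, if and only if \[a=\Delta_{\tau_1}(b_1)+\cdots+\Delta_{\tau_r}(b_r)\] for some $b_1,\dots,b_r\in\mathbb F(\hat{\mathbf x}_1)[x_1]$ with $\deg_{x_1}b_i<\deg_{x_1}d$ for all $1\le i\le r$. (If $G_d$ is trivial, the sum is empty and the condition reads $a=0$.) -/

import Mathlib

open scoped Polynomial

namespace RationalSummation

noncomputable section

/-- The field `F(x_1, …, x_m)` of rational functions; `x_1, …, x_m` are indexed by `Fin m`,
so that `x_1` is the variable with index `0`. -/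
abbrev RatFun (F : Type*) [Field F] (m : ℕ) : Type _ := FractionRing (MvPolynomial (Fin m) F)

/-- The group of `F`-automorphisms of `F(x_1, …, x_m)`. -/
abbrev Aut (F : Type*) [Field F] (m : ℕ) : Type _ := RatFun F m ≃ₐ[F] RatFun F m

/-- The variable with index `i`, as a rational function. -/
def var (F : Type*) [Field F] (m : ℕ) (i : Fin m) : RatFun F m :=
  algebraMap (MvPolynomial (Fin m) F) (RatFun F m) (MvPolynomial.X i)

/-- The substitution `x_i ↦ x_i + c` on polynomials, fixing every other variable. -/
def polyTranslate (F : Type*) [Field F] (m : ℕ) (i : Fin m) (c : F) :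
    MvPolynomial (Fin m) F →ₐ[F] MvPolynomial (Fin m) F :=
  MvPolynomial.aeval fun k =>
    if k = i then MvPolynomial.X k + MvPolynomial.C c else MvPolynomial.X k

theorem polyTranslate_comp (F : Type*) [Field F] (m : ℕ) (i : Fin m) (c c' : F) (h : c + c' = 0) :
    (polyTranslate F m i c).comp (polyTranslate F m i c') = AlgHom.id F _ := by
  ext1 k
  by_cases hk : k = i
  · simp [polyTranslate, hk, add_assoc, ← MvPolynomial.C_add, h]
  · simp [polyTranslate, hk]

/-- The shift `x_i ↦ x_i + 1` as an automorphism of the polynomial ring. -/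
def polyShift (F : Type*) [Field F] (m : ℕ) (i : Fin m) :
    MvPolynomial (Fin m) F ≃ₐ[F] MvPolynomial (Fin m) F :=
  AlgEquiv.ofAlgHom (polyTranslate F m i 1) (polyTranslate F m i (-1))
    (polyTranslate_comp F m i 1 (-1) (by ring)) (polyTranslate_comp F m i (-1) 1 (by ring))

/-- The shift operator `σ_{x_i}`: the `F`-automorphism of `F(x_1, …, x_m)` with
`x_i ↦ x_i + 1` that fixes all other variables. -/
def shift (F : Type*) [Field F] (m : ℕ) (i : Fin m) : Aut F m :=
  IsFractionRing.fieldEquivOfAlgEquiv F (RatFun F m) (RatFun F m) (polyShift F m i)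

/-- The difference operator `Δ_τ(g) = τ(g) - g`. -/
def diff {F : Type*} [Field F] {m : ℕ} (τ : Aut F m) (g : RatFun F m) : RatFun F m := τ g - g

/-- The shift operators `σ_{x_1}, …, σ_{x_n}`, where `n ≤ m`. -/
def firstShifts (F : Type*) [Field F] {n m : ℕ} (h : n ≤ m) : Fin n → Aut F m :=
  fun i => shift F m (Fin.castLE h i)

/-- `f` is `(τ_1, …, τ_r)`-summable in `F(x_1, …, x_m)`. -/
def IsSummable {F : Type*} [Field F] {m r : ℕ} (τ : Fin r → Aut F m) (f : RatFun F m) : Prop :=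
  ∃ g : Fin r → RatFun F m, f = ∑ i, diff (τ i) (g i)

/-- The group `G = ⟨σ_{x_1}, …, σ_{x_n}⟩`. -/
def shiftGroup (F : Type*) [Field F] {n m : ℕ} (h : n ≤ m) : Subgroup (Aut F m) :=
  Subgroup.closure (Set.range (firstShifts F h))

/-- The isotropy group `A_p = {τ ∈ A | τ(p) = p}` of a polynomial `p` in a group `A` of
automorphisms. -/
def isotropy {F : Type*} [Field F] {m : ℕ} (A : Subgroup (Aut F m))
    (p : MvPolynomial (Fin m) F) : Subgroup (Aut F m) :=
  A ⊓ MulAction.stabilizer (Aut F m) (algebraMap (MvPolynomial (Fin m) F) (RatFun F m) p)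

/-- `τ_1, …, τ_r` form a basis of the (free abelian) group `A`: they generate `A`, and
`τ_1 ^ e_1 ⋯ τ_r ^ e_r = 1` with integers `e_i` only if all `e_i` vanish.  For `r = 0`
this says that `A` is trivial. -/
structure IsGroupBasis {F : Type*} [Field F] {m r : ℕ} (A : Subgroup (Aut F m))
    (τ : Fin r → Aut F m) : Prop where
  closure_eq : Subgroup.closure (Set.range τ) = A
  independent : ∀ e : Fin r → ℤ, (List.ofFn fun i => τ i ^ e i).prod = 1 → ∀ i, e i = 0

/-- The subfield `F(x_2, …, x_m)` of `F(x_1, …, x_m)`. -/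
def hatField (F : Type*) [Field F] (m : ℕ) [NeZero m] : IntermediateField F (RatFun F m) :=
  IntermediateField.adjoin F (var F m '' {i | i ≠ 0})

/-- The embedding of the ring `F(x_2, …, x_m)[x_1]` into `F(x_1, …, x_m)`: a univariate
polynomial over `F(x_2, …, x_m)` is evaluated at `x_1`. Its degree is the degree in `x_1`. -/
def ofPoly {F : Type*} [Field F] {m : ℕ} [NeZero m] :
    (hatField F m)[X] →ₐ[hatField F m] RatFun F m :=
  Polynomial.aeval (var F m 0)

end

end RationalSummation

/-!
Write `L` for the field of rational functions, `G` for the group generated by the first `n` shifts,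
`G_d` for the isotropy group of `d`, and `deg` for the degree in `x_1`. If `deg d = 0`, then `a = 0`
and there is nothing to prove, so let `deg d > 0`.

Differences along any element of a group are sums of differences along generators
(`diff_mem_coboundaries`). As `G_d` fixes `d`, dividing `a = ∑ Δ_{τ_i}(b_i)` by `d ^ j` hence shows
that `a / d ^ j` is summable.

For the converse, every rational function has a `d`-adic expansion with coefficients in the space
`V` of polynomials in `x_1` of degree less than `deg d` over the field of the remaining variables
(`isCompl_residues`). Existence rests on Gauss's lemma, which makes `d` invertible modulo what it
does not divide once the other variables may be inverted; uniqueness is a comparison of degrees.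
By uniqueness, taking a coefficient commutes with `G_d` (`residue_map`). The coefficient of order
`-j` at another member `g d` of the orbit of `d` is transported back to `V` by `g⁻¹`; modulo
`B = ∑ Δ_{τ_i}(V)` the outcome depends only on the coset `g G_d`. Summing over all cosets gives an
additive map `L → L ⧸ B`, the `transfer`. It is `G`-invariant, since an element of `G` only
permutes the cosets, and therefore kills every sum of differences (`transfer_diff`); but it maps
`a / d ^ j` to the class of `a` (`transfer_div_pow`). So if `a / d ^ j` is summable, then `a ∈ B`.

The sum is finite because the denominator of a rational function has only finitely many irreducible
factors, and because two translates of `d` that differ by a constant factor coincide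
(`translate_eq_of_associated`).

Instead of univariate polynomials over the field of the variables other than `x_1`, the argument
uses fractions of multivariate polynomials with denominators free of `x_1`, on which translations
act directly; `mem_boundedFractions_iff` compares the two descriptions of `V`.
-/

open scoped Polynomial

namespace RationalSummation

open MvPolynomial

/-! ### Gauss's lemma and division with denominators -/

section OneVariable

variable {R : Type*} [CommRing R] [IsDomain R]

theorem exists_pseudo_division (p q : R[X]) (hq : q ≠ 0) :
    ∃ b : R, b ≠ 0 ∧ ∃ s t : R[X], Polynomial.C b * p = s * q + t ∧ t.degree < q.degree := by
  set K := FractionRing R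
  have inj := IsFractionRing.injective R K
  have hq' : q.map (algebraMap R K) ≠ 0 := (Polynomial.map_ne_zero_iff inj).2 hq
  obtain ⟨b, hb, hs⟩ := IsLocalization.integerNormalization_spec (nonZeroDivisors R)
    (p.map (algebraMap R K) / q.map (algebraMap R K))
  obtain ⟨c, hc, ht⟩ := IsLocalization.integerNormalization_spec (nonZeroDivisors R)
    (p.map (algebraMap R K) % q.map (algebraMap R K))
  set s := IsLocalization.integerNormalization (nonZeroDivisors R)
    (p.map (algebraMap R K) / q.map (algebraMap R K))
  set t := IsLocalization.integerNormalization (nonZeroDivisors R)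
    (p.map (algebraMap R K) % q.map (algebraMap R K))
  have hb0 := nonZeroDivisors.ne_zero hb
  have hc0 := nonZeroDivisors.ne_zero hc
  refine ⟨b * c, mul_ne_zero hb0 hc0, Polynomial.C c * s, Polynomial.C b * t, ?_, ?_⟩
  · apply Polynomial.map_injective _ inj
    have h := EuclideanDomain.div_add_mod (p.map (algebraMap R K)) (q.map (algebraMap R K))
    rw [Algebra.smul_def, Polynomial.algebraMap_apply] at hs ht
    simp only [Polynomial.map_mul, Polynomial.map_add, Polynomial.map_C, hs, ht, map_mul]
    linear_combination (-(Polynomial.C (algebraMap R K b) * Polynomial.C (algebraMap R K c))) * h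
  · have h1 : t.degree ≤ (p.map (algebraMap R K) % q.map (algebraMap R K)).degree :=
      Polynomial.degree_mono (IsLocalization.integerNormalization_support _ _)
    rw [Polynomial.degree_C_mul hb0]
    refine h1.trans_lt ((EuclideanDomain.mod_lt _ hq').trans_eq ?_)
    exact Polynomial.degree_map_eq_of_injective inj _

/-- By Gauss's lemma an irreducible polynomial of positive degree over a unique factorization
domain stays irreducible over the fraction field, so it is coprime there to everything it does not
divide; clearing denominators in the Bézout identity gives this relation. -/
theorem exists_bezout_of_irreducible [UniqueFactorizationMonoid R] {p q : R[X]}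
    (hp : Irreducible p) (hdeg : p.natDegree ≠ 0) (hpq : ¬p ∣ q) (k : ℕ) :
    ∃ b : R, b ≠ 0 ∧ ∃ s t : R[X], Polynomial.C b = s * q + t * p ^ k := by
  set K := FractionRing R
  have inj := IsFractionRing.injective R K
  have hprim := hp.isPrimitive hdeg
  have hirr : Irreducible (p.map (algebraMap R K)) :=
    hprim.irreducible_iff_irreducible_map_fraction_map.1 hp
  have hndvd : ¬p.map (algebraMap R K) ∣ q.map (algebraMap R K) := fun h =>
    hpq (hprim.dvd_of_fraction_map_dvd_fraction_map h)
  obtain ⟨x, y, hxy⟩ := ((hirr.coprime_iff_not_dvd.2 hndvd).symm.pow_right (n := k))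
  obtain ⟨b, hb, hs⟩ := IsLocalization.integerNormalization_spec (nonZeroDivisors R) x
  obtain ⟨c, hc, ht⟩ := IsLocalization.integerNormalization_spec (nonZeroDivisors R) y
  refine ⟨b * c, mul_ne_zero (nonZeroDivisors.ne_zero hb) (nonZeroDivisors.ne_zero hc),
    Polynomial.C c * IsLocalization.integerNormalization (nonZeroDivisors R) x,
    Polynomial.C b * IsLocalization.integerNormalization (nonZeroDivisors R) y, ?_⟩
  apply Polynomial.map_injective _ inj
  rw [Algebra.smul_def, Polynomial.algebraMap_apply] at hs ht
  simp only [Polynomial.map_mul, Polynomial.map_add, Polynomial.map_C, hs, ht, map_mul,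
    Polynomial.map_pow]
  linear_combination (-(Polynomial.C (algebraMap R K b) * Polynomial.C (algebraMap R K c))) * hxy

end OneVariable

section FirstVariable

variable {F : Type*} [Field F] {m : ℕ} [NeZero m]

/-- The polynomials whose degree in `x_1` is less than `k`; the zero polynomial always belongs,
also for `k = 0`. -/
noncomputable def degLT (F : Type*) [Field F] (m : ℕ) [NeZero m] (k : ℕ) :
    Submodule F (MvPolynomial (Fin m) F) :=
  restrictSupport F {s | s 0 < k}

theorem mem_degLT {k : ℕ} {p : MvPolynomial (Fin m) F} :
    p ∈ degLT F m k ↔ ∀ s ∈ p.support, s 0 < k := by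
  simp [degLT, mem_restrictSupport_iff, Set.subset_def]

theorem mem_degLT_iff_of_ne_zero {k : ℕ} {p : MvPolynomial (Fin m) F} (hp : p ≠ 0) :
    p ∈ degLT F m k ↔ degreeOf 0 p < k := by
  rcases Nat.eq_zero_or_pos k with rfl | hk
  · obtain ⟨s, hs⟩ := support_nonempty.2 hp
    simp only [mem_degLT, not_lt_zero, imp_false, iff_false, not_forall, not_not]
    exact ⟨s, hs⟩
  · rw [mem_degLT, degreeOf_lt_iff hk]

theorem degLT_mono {k l : ℕ} (h : k ≤ l) : degLT F m k ≤ degLT F m l := fun _ hp =>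
  mem_degLT.2 fun s hs => (mem_degLT.1 hp s hs).trans_le h

theorem mul_mem_degLT {k l : ℕ} {p q : MvPolynomial (Fin m) F} (hp : p ∈ degLT F m k)
    (h : k + degreeOf 0 q ≤ l) : p * q ∈ degLT F m l := by
  classical
  refine mem_degLT.2 fun s hs => ?_
  obtain ⟨u, hu, v, hv, rfl⟩ := Finset.mem_add.1 (support_mul p q hs)
  exact (add_lt_add_of_lt_of_le (mem_degLT.1 hp u hu) (degreeOf_le_iff.1 le_rfl v hv)).trans_le h

/-- Nonzero polynomials in which `x_1` does not occur. -/
def hatDenominators (F : Type*) [Field F] (m : ℕ) [NeZero m] :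
    Submonoid (MvPolynomial (Fin m) F) where
  carrier := {b | b ≠ 0 ∧ degreeOf 0 b = 0}
  one_mem' := ⟨one_ne_zero, degreeOf_one _⟩
  mul_mem' := fun ha hb => ⟨mul_ne_zero ha.1 hb.1, by rw [degreeOf_mul_eq ha.1 hb.1, ha.2, hb.2]⟩

theorem exists_division (p q : MvPolynomial (Fin m) F) (hq : q ≠ 0) :
    ∃ b ∈ hatDenominators F m, ∃ s t : MvPolynomial (Fin m) F,
      b * p = s * q + t ∧ t ∈ degLT F m (degreeOf 0 q) := by
  obtain ⟨m, rfl⟩ := Nat.exists_eq_succ_of_ne_zero (NeZero.ne m)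
  set e := finSuccEquiv F m
  obtain ⟨b, hb, s, t, h, ht⟩ := exists_pseudo_division (e p) (e q)
    ((map_ne_zero_iff e e.injective).2 hq)
  refine ⟨e.symm (Polynomial.C b), ⟨?_, ?_⟩, e.symm s, e.symm t, ?_, ?_⟩
  · simpa using hb
  · have := natDegree_finSuccEquiv (e.symm (Polynomial.C b))
    rw [AlgEquiv.apply_symm_apply, Polynomial.natDegree_C] at this
    exact this.symm
  · apply e.injective
    simpa using h
  · by_cases h0 : t = 0
    · simp [h0]
    have h0' : e.symm t ≠ 0 := (map_ne_zero_iff e.symm e.symm.injective).2 h0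
    refine (mem_degLT_iff_of_ne_zero h0').2 ?_
    have h1 := degree_finSuccEquiv h0'
    have h2 := degree_finSuccEquiv hq
    rw [AlgEquiv.apply_symm_apply] at h1
    rw [h1, h2] at ht
    exact_mod_cast ht

theorem exists_bezout {d β : MvPolynomial (Fin m) F} (hd : Irreducible d)
    (hdeg : degreeOf 0 d ≠ 0) (hβ : ¬d ∣ β) (k : ℕ) :
    ∃ b ∈ hatDenominators F m, ∃ s t : MvPolynomial (Fin m) F, b = s * β + t * d ^ k := by
  obtain ⟨m, rfl⟩ := Nat.exists_eq_succ_of_ne_zero (NeZero.ne m)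
  set e := finSuccEquiv F m
  obtain ⟨b, hb, s, t, h⟩ := exists_bezout_of_irreducible (p := e d) (q := e β)
    ((MulEquiv.irreducible_iff e).2 hd) (by
      have := natDegree_finSuccEquiv d
      rw [this]; exact hdeg) (fun h => hβ ((map_dvd_iff e).1 h)) k
  refine ⟨e.symm (Polynomial.C b), ⟨?_, ?_⟩, e.symm s, e.symm t, ?_⟩
  · simpa using hb
  · have := natDegree_finSuccEquiv (e.symm (Polynomial.C b))
    rw [AlgEquiv.apply_symm_apply, Polynomial.natDegree_C] at this
    exact this.symm
  · apply e.injective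
    simpa using h

end FirstVariable

/-! ### Translations -/

section Translation

variable {F : Type*} [Field F] {m : ℕ}

theorem aeval_X_add_C_comp (c c' : Fin m → F) :
    (aeval fun k => X k + C (c k) : MvPolynomial (Fin m) F →ₐ[F] MvPolynomial (Fin m) F).comp
      (aeval fun k => X k + C (c' k)) = aeval fun k => X k + C ((c + c') k) := by
  ext1 k
  simp [add_assoc]

theorem aeval_X_add_C_zero :
    (aeval fun k => X k + C ((0 : Fin m → F) k) :
      MvPolynomial (Fin m) F →ₐ[F] MvPolynomial (Fin m) F) = AlgHom.id F _ := by
  ext1 k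
  simp

/-- The substitution `x ↦ x + c` for a vector `c`. -/
noncomputable def translate (c : Fin m → F) :
    MvPolynomial (Fin m) F ≃ₐ[F] MvPolynomial (Fin m) F :=
  AlgEquiv.ofAlgHom (aeval fun k => X k + C (c k)) (aeval fun k => X k + C ((-c) k))
    (by rw [aeval_X_add_C_comp, add_neg_cancel, aeval_X_add_C_zero])
    (by rw [aeval_X_add_C_comp, neg_add_cancel, aeval_X_add_C_zero])

theorem translate_apply (c : Fin m → F) (p : MvPolynomial (Fin m) F) :
    translate c p = aeval (fun k => X k + C (c k)) p := rfl

theorem translate_add_apply (c c' : Fin m → F) (p : MvPolynomial (Fin m) F) :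
    translate (c + c') p = translate c (translate c' p) :=
  (DFunLike.congr_fun (aeval_X_add_C_comp c c') p).symm

theorem translate_zero_apply (p : MvPolynomial (Fin m) F) : translate 0 p = p :=
  DFunLike.congr_fun aeval_X_add_C_zero p

theorem degreeOf_translate_le (c : Fin m → F) (i : Fin m) (p : MvPolynomial (Fin m) F) :
    degreeOf i (translate c p) ≤ degreeOf i p := by
  classical
  rw [translate_apply, aeval_def, eval₂_eq']
  refine (degreeOf_sum_le _ _ _).trans (Finset.sup_le fun s hs => ?_)
  refine (degreeOf_C_mul_le _ _ _).trans ?_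
  refine (degreeOf_prod_le _ _ _).trans (le_trans ?_ (degreeOf_le_iff.1 le_rfl s hs))
  have h : ∀ j, degreeOf i ((X j + C (c j) : MvPolynomial (Fin m) F) ^ s j) ≤
      if i = j then s j else 0 := fun j => by
    refine (degreeOf_pow_le _ _ _).trans ?_
    have : degreeOf i (X j + C (c j) : MvPolynomial (Fin m) F) ≤ if i = j then 1 else 0 := by
      refine (degreeOf_add_le _ _ _).trans ?_
      rw [degreeOf_X, degreeOf_C, max_eq_left (Nat.zero_le _)]
    refine (Nat.mul_le_mul_left _ this).trans ?_
    split_ifs <;> simp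
  refine (Finset.sum_le_sum fun j _ => h j).trans ?_
  simp

theorem degreeOf_translate (c : Fin m → F) (i : Fin m) (p : MvPolynomial (Fin m) F) :
    degreeOf i (translate c p) = degreeOf i p := by
  refine (degreeOf_translate_le c i p).antisymm ?_
  conv_lhs => rw [← translate_zero_apply p, ← neg_add_cancel c, translate_add_apply]
  exact degreeOf_translate_le _ i _

/-- A translation multiplies no polynomial by a nontrivial constant: `t ↦ p (x + t c)` is a
polynomial in `t`, and the substitution `t ↦ t + 1` preserves its leading coefficient. -/
theorem translate_eq_of_associated {c : Fin m → F} {p : MvPolynomial (Fin m) F}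
    (h : Associated (translate c p) p) : translate c p = p := by
  by_cases hp : p = 0
  · rw [hp, map_zero]
  obtain ⟨u, hu⟩ := h.symm
  obtain ⟨a, -, ha⟩ := isUnit_iff_eq_C_of_isReduced.1 u.isUnit
  let line : MvPolynomial (Fin m) F →ₐ[F] (MvPolynomial (Fin m) F)[X] :=
    aeval fun k => Polynomial.C (X k) + Polynomial.C (C (c k)) * Polynomial.X
  have htaylor : ∀ q, Polynomial.taylorAlgHom (1 : MvPolynomial (Fin m) F) (line q) =
      line (translate c q) := by
    intro q
    have : ((Polynomial.taylorAlgHom (1 : MvPolynomial (Fin m) F)).restrictScalars F).comp line =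
        line.comp (translate c).toAlgHom := by
      ext1 k
      simp [line, translate_apply, Polynomial.taylor_apply, Polynomial.algebraMap_apply]
      ring
    exact DFunLike.congr_fun this q
  have heval : ∀ q, (line q).eval 0 = q := by
    intro q
    have : ((Polynomial.aeval (0 : MvPolynomial (Fin m) F)).restrictScalars F).comp line =
        AlgHom.id F _ := by
      ext1 k
      simp [line]
    have := DFunLike.congr_fun this q
    simpa [Polynomial.aeval_def] using this
  have hline : line p ≠ 0 := fun h0 => hp (by rw [← heval p, h0, Polynomial.eval_zero])
  have hC : line (C a) = Polynomial.C (C a) := by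
    rw [← algebraMap_eq, AlgHom.commutes]; rfl
  have h1 := congrArg Polynomial.leadingCoeff (htaylor p)
  rw [Polynomial.taylorAlgHom_apply, Polynomial.leadingCoeff_taylor, ← hu, ha, map_mul, hC,
    Polynomial.leadingCoeff_mul, Polynomial.leadingCoeff_C] at h1
  have h2 : (C a : MvPolynomial (Fin m) F) = 1 :=
    mul_left_cancel₀ (Polynomial.leadingCoeff_ne_zero.2 hline) (by rw [← h1, mul_one])
  rw [← hu, ha, h2, mul_one]

/-- The automorphism `τ` of the field of rational functions is the substitution `x ↦ x + c`. -/
def IsTranslation (τ : Aut F m) (c : Fin m → F) : Prop :=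
  ∀ p : MvPolynomial (Fin m) F,
    τ (algebraMap _ (RatFun F m) p) = algebraMap _ (RatFun F m) (translate c p)

theorem IsTranslation.inv {τ : Aut F m} {c : Fin m → F} (hτ : IsTranslation τ c) :
    IsTranslation τ⁻¹ (-c) := fun p => τ.injective <| by
  rw [hτ, ← translate_add_apply, add_neg_cancel, translate_zero_apply, ← AlgEquiv.mul_apply,
    mul_inv_cancel, AlgEquiv.one_apply]

theorem IsTranslation.mul {τ ρ : Aut F m} {c c' : Fin m → F} (hτ : IsTranslation τ c)
    (hρ : IsTranslation ρ c') : IsTranslation (τ * ρ) (c + c') := fun p => by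
  rw [AlgEquiv.mul_apply, hρ, hτ, translate_add_apply]

theorem isTranslation_shift (i : Fin m) : IsTranslation (shift F m i) (Pi.single i 1) := by
  intro p
  refine (IsFractionRing.fieldEquivOfAlgEquiv_algebraMap F _ _ _ p).trans (congrArg _ ?_)
  refine DFunLike.congr_fun (?_ : polyTranslate F m i 1 = (translate _).toAlgHom) p
  ext1 k
  by_cases hk : k = i
  · subst hk; simp [polyTranslate, translate_apply]
  · simp [polyTranslate, translate_apply, hk]

/-- Each element of `⟨σ_{x_1}, …, σ_{x_n}⟩` is a translation. -/
theorem exists_isTranslation {n : ℕ} (h : n ≤ m) {τ : Aut F m} (hτ : τ ∈ shiftGroup F h) :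
    ∃ c, IsTranslation τ c := by
  induction hτ using Subgroup.closure_induction with
  | mem τ hτ =>
    obtain ⟨i, rfl⟩ := hτ
    exact ⟨_, isTranslation_shift _⟩
  | one => exact ⟨0, fun p => by rw [translate_zero_apply]; rfl⟩
  | mul τ ρ _ _ hτ hρ =>
    obtain ⟨c, hc⟩ := hτ
    obtain ⟨c', hc'⟩ := hρ
    exact ⟨_, hc.mul hc'⟩
  | inv τ _ hτ =>
    obtain ⟨c, hc⟩ := hτ
    exact ⟨_, hc.inv⟩

end Translation

/-! ### Splitting off the leading part at an irreducible polynomial -/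

section Splitting

theorem partial_fraction_identity {K : Type*} [Field K] {α β d D b b₁ b₂ x y q r v s : K}
    (hβ : β ≠ 0) (hD : D ≠ 0) (hb : b ≠ 0) (hb₁ : b₁ ≠ 0) (hb₂ : b₂ ≠ 0)
    (h : b = x * β + y * (D * d)) (h₁ : b₁ * (α * x) = q * (D * d) + r)
    (h₂ : b₂ * r = v * D + s) :
    α / (D * β) = v / (b * b₁ * b₂) +
      ((d * q / (b * b₁) + d * (α * y) / (b * β)) + s / (b * b₁ * b₂ * D)) := by
  have : s = b₂ * (b₁ * (α * x) - q * (D * d)) - v * D := by linear_combination -h₂ - b₂ * h₁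
  subst this
  field_simp
  linear_combination (α * b₁ * b₂) * h

theorem algebraMap_ratFun_injective {F : Type*} [Field F] {m : ℕ} :
    Function.Injective (algebraMap (MvPolynomial (Fin m) F) (RatFun F m)) :=
  IsFractionRing.injective _ _

variable {F : Type*} [Field F] {m : ℕ}

local notation "ι" => algebraMap (MvPolynomial (Fin m) F) (RatFun F m)

theorem smul_mul_algebraMap {u : RatFun F m} {b s : MvPolynomial (Fin m) F} (c : F)
    (h : u * ι b = ι s) : c • u * ι b = ι (c • s) := by
  rw [smul_mul_assoc, h, Algebra.smul_def, smul_eq_C_mul, map_mul]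
  rfl

variable [NeZero m]

/-- The fractions `s / b` with denominator `b ∈ S` and `deg s < deg b + k`, where `deg` is the
degree in `x_1` and `deg 0 = -∞`. For `k = 0` these are the fractions that are proper in `x_1`. -/
noncomputable def boundedFractions (S : Submonoid (MvPolynomial (Fin m) F)) (k : ℕ) :
    Submodule F (RatFun F m) where
  carrier := {u | ∃ b ∈ S, b ≠ 0 ∧ ∃ s ∈ degLT F m (degreeOf 0 b + k), u * ι b = ι s}
  zero_mem' := ⟨1, S.one_mem, one_ne_zero, 0, zero_mem _, by simp⟩
  add_mem' := by
    rintro u v ⟨b, hb, hb0, s, hs, h⟩ ⟨c, hc, hc0, t, ht, h'⟩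
    refine ⟨b * c, S.mul_mem hb hc, mul_ne_zero hb0 hc0, s * c + t * b, add_mem ?_ ?_, ?_⟩
    · refine mul_mem_degLT hs ?_
      rw [degreeOf_mul_eq hb0 hc0]
      omega
    · refine mul_mem_degLT ht ?_
      rw [degreeOf_mul_eq hb0 hc0]
      omega
    · simp only [map_mul, map_add]
      linear_combination ι c * h + ι b * h'
  smul_mem' := by
    rintro c u ⟨b, hb, hb0, s, hs, h⟩
    exact ⟨b, hb, hb0, c • s, Submodule.smul_mem _ c hs, smul_mul_algebraMap c h⟩

/-- The maximal ideal of the local ring at the prime `d`: the rational functions whose numerator,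
but not whose denominator, is divisible by `d`. -/
noncomputable def vanishingAt (d : MvPolynomial (Fin m) F) (hd : Prime d) :
    Submodule F (RatFun F m) where
  carrier := {u | ∃ b, ¬d ∣ b ∧ ∃ s, u * ι b = ι (d * s)}
  zero_mem' := ⟨1, hd.not_dvd_one, 0, by simp⟩
  add_mem' := by
    rintro u v ⟨b, hb, s, h⟩ ⟨c, hc, t, h'⟩
    refine ⟨b * c, fun hdvd => (hd.dvd_or_dvd hdvd).elim hb hc, s * c + t * b, ?_⟩
    simp only [map_mul, map_add] at h h' ⊢
    linear_combination ι c * h + ι b * h'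
  smul_mem' := by
    rintro c u ⟨b, hb, s, h⟩
    exact ⟨b, hb, c • s, by rw [mul_smul_comm]; exact smul_mul_algebraMap c h⟩

/-- The residues at `d`: fractions of degree less than `deg d` in `x_1`, with a denominator free
of `x_1`. -/
noncomputable abbrev residues (d : MvPolynomial (Fin m) F) : Submodule F (RatFun F m) :=
  boundedFractions (hatDenominators F m) (degreeOf 0 d)

/-- The fractions `s / (b d ^ N)`, proper in `x_1`, with `b` free of `x_1`. -/
noncomputable abbrev properAt (d : MvPolynomial (Fin m) F) : Submodule F (RatFun F m) :=
  boundedFractions (hatDenominators F m ⊔ Submonoid.powers d) 0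

theorem eq_zero_of_dvd_of_mem_degLT {p q : MvPolynomial (Fin m) F} (h : p ∣ q)
    (hq : q ∈ degLT F m (degreeOf 0 p)) : q = 0 := by
  by_contra h0
  obtain ⟨r, rfl⟩ := h
  have h1 := (mem_degLT_iff_of_ne_zero h0).1 hq
  rw [degreeOf_mul_eq (left_ne_zero_of_mul h0) (right_ne_zero_of_mul h0)] at h1
  omega

theorem not_dvd_of_mem_hatDenominators {d b : MvPolynomial (Fin m) F} (hdeg : degreeOf 0 d ≠ 0)
    (hb : b ∈ hatDenominators F m) : ¬d ∣ b := fun h =>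
  hb.1 (eq_zero_of_dvd_of_mem_degLT h ((mem_degLT_iff_of_ne_zero hb.1).2 (by
    rw [hb.2]; exact Nat.pos_of_ne_zero hdeg)))

theorem disjoint_residues {d : MvPolynomial (Fin m) F} (hd : Prime d) :
    Disjoint (residues d) (vanishingAt d hd ⊔ properAt d) := by
  refine Submodule.disjoint_def.2 fun u hu hu' => ?_
  obtain ⟨w, ⟨β, hβ, α, hw⟩, z, ⟨_, hcd, -, t, ht, hz⟩, rfl⟩ := Submodule.mem_sup.1 hu'
  obtain ⟨c, hc, _, ⟨N, rfl⟩, rfl⟩ := Submonoid.mem_sup.1 hcd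
  obtain ⟨b, hb, hb0, s, hs, h⟩ := hu
  have hdN : d ^ N ≠ 0 := pow_ne_zero _ hd.ne_zero
  dsimp only at ht hz
  rw [degreeOf_mul_eq hc.1 hdN, hc.2, degreeOf_pow_eq _ _ _ hd.ne_zero, zero_add, add_zero] at ht
  rw [hb.2, zero_add] at hs
  have key : β * (s * c * d ^ N - t * b) = d ^ (N + 1) * (α * b * c) := by
    apply algebraMap_ratFun_injective
    simp only [map_mul, map_sub, map_pow] at h hw hz ⊢
    linear_combination (-(ι β * ι c * ι d ^ N)) * h + ι b * ι c * ι d ^ N * hw + ι β * ι b * hz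
  have h1 : s * c * d ^ N - t * b = 0 := by
    refine eq_zero_of_dvd_of_mem_degLT (p := d ^ (N + 1))
      (hd.pow_dvd_of_dvd_mul_left _ hβ (Dvd.intro _ key.symm)) ?_
    rw [degreeOf_pow_eq _ _ _ hd.ne_zero]
    refine sub_mem (mul_mem_degLT (k := degreeOf 0 d) (mul_mem_degLT hs ?_) ?_)
      (mul_mem_degLT ht ?_)
    · rw [hc.2, add_zero]
    · rw [degreeOf_pow_eq _ _ _ hd.ne_zero, add_one_mul, add_comm]
    · rw [hb.2, add_zero, add_one_mul]
      exact Nat.le_add_right _ _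
  have h2 : t * b = 0 := by
    refine eq_zero_of_dvd_of_mem_degLT (p := d ^ N)
      (Dvd.intro_left (s * c) (sub_eq_zero.1 h1)) ?_
    rw [degreeOf_pow_eq _ _ _ hd.ne_zero]
    exact mul_mem_degLT ht (by rw [hb.2, add_zero])
  rw [h2, sub_zero] at h1
  have hs0 : s = 0 := by simpa [hc.1, hdN] using h1
  rw [hs0, map_zero] at h
  exact (mul_eq_zero.1 h).resolve_right ((map_ne_zero_iff _ algebraMap_ratFun_injective).2 hb0)

theorem codisjoint_residues {d : MvPolynomial (Fin m) F} (hd : Prime d)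
    (hdeg : degreeOf 0 d ≠ 0) : Codisjoint (residues d) (vanishingAt d hd ⊔ properAt d) := by
  rw [codisjoint_iff_le_sup]
  rintro u -
  obtain ⟨α, β₀, hβ₀, rfl⟩ := IsFractionRing.div_surjective (A := MvPolynomial (Fin m) F) u
  have hβ₀' := nonZeroDivisors.ne_zero hβ₀
  obtain ⟨N, β, hβ, rfl⟩ :=
    WfDvdMonoid.max_power_factor hβ₀' hd.irreducible
  have hdN : d ^ N ≠ 0 := pow_ne_zero _ hd.ne_zero
  have hdN1 : d ^ (N + 1) ≠ 0 := pow_ne_zero _ hd.ne_zero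
  obtain ⟨b, hb, x, y, hxy⟩ := exists_bezout hd.irreducible hdeg hβ (N + 1)
  -- Two divisions: by `d ^ (N + 1)`, then of the remainder by `d ^ N`.
  obtain ⟨b₁, hb₁, q, r, hqr, hr⟩ := exists_division (α * x) (d ^ (N + 1)) hdN1
  obtain ⟨b₂, hb₂, v, s, hvs, hs⟩ := exists_division r (d ^ N) hdN
  have hv : v ∈ degLT F m (degreeOf 0 d) := by
    by_cases hv0 : v = 0
    · rw [hv0]; exact zero_mem _
    have h1 : v * d ^ N ∈ degLT F m (degreeOf 0 (d ^ (N + 1))) := by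
      have : v * d ^ N = r * b₂ - s := by linear_combination -hvs
      rw [this]
      refine sub_mem (mul_mem_degLT hr (by rw [hb₂.2, add_zero])) (degLT_mono ?_ hs)
      rw [degreeOf_pow_eq _ _ _ hd.ne_zero, degreeOf_pow_eq _ _ _ hd.ne_zero, add_one_mul]
      exact Nat.le_add_right _ _
    rw [mem_degLT_iff_of_ne_zero (mul_ne_zero hv0 hdN), degreeOf_mul_eq hv0 hdN,
      degreeOf_pow_eq _ _ _ hd.ne_zero, degreeOf_pow_eq _ _ _ hd.ne_zero, add_one_mul] at h1
    rw [mem_degLT_iff_of_ne_zero hv0]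
    omega
  have hB : b * b₁ * b₂ ∈ hatDenominators F m := mul_mem (mul_mem hb hb₁) hb₂
  have hne : ∀ p : MvPolynomial (Fin m) F, p ≠ 0 → ι p ≠ 0 := fun p hp =>
    (map_ne_zero_iff _ algebraMap_ratFun_injective).2 hp
  have hβ0 : β ≠ 0 := right_ne_zero_of_mul hβ₀'
  have e1 := hne _ hb.1
  have e2 := hne _ hb₁.1
  have e3 := hne _ hb₂.1
  have e4 := hne _ hβ0
  have hsum : ι α / ι (d ^ N * β) = ι v / ι (b * b₁ * b₂) +
      ((ι (d * q) / ι (b * b₁) + ι (d * (α * y)) / ι (b * β)) +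
        ι s / ι (b * b₁ * b₂ * d ^ N)) := by
    have hxy' := congrArg ι hxy
    have hqr' := congrArg ι hqr
    have hvs' := congrArg ι hvs
    simp only [map_mul, map_add, pow_succ] at hxy' hqr' hvs' ⊢
    exact partial_fraction_identity e4 (hne _ hdN) e1 e2 e3 hxy' hqr' hvs'
  rw [hsum]
  refine Submodule.add_mem_sup ?_ (Submodule.add_mem_sup (add_mem ?_ ?_) ?_)
  · refine ⟨_, hB, hB.1, v, degLT_mono (Nat.le_add_left _ _) hv, ?_⟩
    exact div_mul_cancel₀ _ (hne _ hB.1)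
  · refine ⟨_, not_dvd_of_mem_hatDenominators hdeg (mul_mem hb hb₁), q, ?_⟩
    exact div_mul_cancel₀ _ (hne _ (mul_mem hb hb₁).1)
  · refine ⟨_, fun h => (hd.dvd_or_dvd h).elim (not_dvd_of_mem_hatDenominators hdeg hb) hβ,
      α * y, div_mul_cancel₀ _ (hne _ (mul_ne_zero hb.1 hβ0))⟩
  · have hBd : b * b₁ * b₂ * d ^ N ≠ 0 := mul_ne_zero hB.1 hdN
    refine ⟨_, Submonoid.mul_mem_sup hB ⟨N, rfl⟩, hBd, s, ?_, div_mul_cancel₀ _ (hne _ hBd)⟩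
    rw [degreeOf_mul_eq hB.1 hdN, hB.2, zero_add, add_zero]
    exact hs

/-- In the `d`-adic expansion of a rational function, with coefficients of degree less than
`deg d` in `x_1`, the terms of positive order lie in `vanishingAt d`, those of negative order in
`properAt d`, and the coefficient of order zero in `residues d`. -/
theorem isCompl_residues {d : MvPolynomial (Fin m) F} (hd : Prime d) (hdeg : degreeOf 0 d ≠ 0) :
    IsCompl (residues d) (vanishingAt d hd ⊔ properAt d) :=
  ⟨disjoint_residues hd, codisjoint_residues hd hdeg⟩

/-- The coefficient of order zero in the `d`-adic expansion. -/
noncomputable def residue (d : MvPolynomial (Fin m) F) (hd : Prime d) (hdeg : degreeOf 0 d ≠ 0) :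
    RatFun F m →ₗ[F] RatFun F m :=
  (residues d).projection _ (isCompl_residues hd hdeg)

variable {d : MvPolynomial (Fin m) F} (hd : Prime d) (hdeg : degreeOf 0 d ≠ 0)

theorem residue_mem (u : RatFun F m) : residue d hd hdeg u ∈ residues d :=
  Submodule.projection_apply_mem _ u

theorem residue_of_mem {u : RatFun F m} (hu : u ∈ residues d) : residue d hd hdeg u = u :=
  Submodule.projection_apply_of_mem_left _ hu

theorem residue_eq_zero_of_mem_vanishingAt {u : RatFun F m} (hu : u ∈ vanishingAt d hd) :
    residue d hd hdeg u = 0 :=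
  (Submodule.projection_apply_eq_zero_iff _).2 (Submodule.mem_sup_left hu)

theorem translate_mem_degLT (c : Fin m → F) {k : ℕ} {p : MvPolynomial (Fin m) F}
    (hp : p ∈ degLT F m k) : translate c p ∈ degLT F m k := by
  by_cases h0 : p = 0
  · rw [h0, map_zero]; exact zero_mem _
  · rw [mem_degLT_iff_of_ne_zero ((map_ne_zero_iff _ (translate c).injective).2 h0),
      degreeOf_translate]
    exact (mem_degLT_iff_of_ne_zero h0).1 hp

theorem translate_mem_hatDenominators (c : Fin m → F) {b : MvPolynomial (Fin m) F}
    (hb : b ∈ hatDenominators F m) : translate c b ∈ hatDenominators F m :=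
  ⟨(map_ne_zero_iff _ (translate c).injective).2 hb.1, (degreeOf_translate c 0 b).trans hb.2⟩

variable {τ : Aut F m} {c : Fin m → F}

theorem map_mem_boundedFractions (hτ : IsTranslation τ c)
    {S : Submonoid (MvPolynomial (Fin m) F)} {k : ℕ} (hS : ∀ b ∈ S, translate c b ∈ S)
    {u : RatFun F m} (hu : u ∈ boundedFractions S k) : τ u ∈ boundedFractions S k := by
  obtain ⟨b, hb, hb0, s, hs, h⟩ := hu
  refine ⟨translate c b, hS b hb, (map_ne_zero_iff _ (translate c).injective).2 hb0,
    translate c s, ?_, ?_⟩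
  · rw [degreeOf_translate]; exact translate_mem_degLT c hs
  · rw [← hτ, ← hτ, ← map_mul, h]

theorem map_mem_residues (hτ : IsTranslation τ c) {u : RatFun F m} (hu : u ∈ residues d) :
    τ u ∈ residues d :=
  map_mem_boundedFractions hτ (fun _ => translate_mem_hatDenominators c) hu

theorem residue_map (hτ : IsTranslation τ c) (hcd : translate c d = d) (u : RatFun F m) :
    residue d hd hdeg (τ u) = τ (residue d hd hdeg u) := by
  have hu : u ∈ residues d ⊔ (vanishingAt d hd ⊔ properAt d) := by
    rw [(isCompl_residues hd hdeg).sup_eq_top]; trivial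
  obtain ⟨v, hv, w, hw, rfl⟩ := Submodule.mem_sup.1 hu
  obtain ⟨y, ⟨b, hb, s, h⟩, z, hz, rfl⟩ := Submodule.mem_sup.1 hw
  have hy : τ y ∈ vanishingAt d hd := by
    refine ⟨translate c b, fun hdvd => hb ((map_dvd_iff (translate c)).1 (by rwa [hcd])),
      translate c s, ?_⟩
    rw [← hτ, ← map_mul τ, h, hτ, map_mul (translate c), hcd]
  have hz' : τ z ∈ properAt d := by
    refine map_mem_boundedFractions hτ (fun b hb => ?_) hz
    obtain ⟨b', hb', _, ⟨N, rfl⟩, rfl⟩ := Submonoid.mem_sup.1 hb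
    simp only [map_mul, map_pow, hcd]
    exact Submonoid.mul_mem_sup (translate_mem_hatDenominators c hb') ⟨N, rfl⟩
  have h1 : ∀ w ∈ vanishingAt d hd ⊔ properAt d, residue d hd hdeg w = 0 := fun w hw =>
    (Submodule.projection_apply_eq_zero_iff _).2 hw
  rw [map_add τ, map_add (residue d hd hdeg), map_add (residue d hd hdeg),
    residue_of_mem hd hdeg hv, h1 _ hw, add_zero,
    residue_of_mem hd hdeg (map_mem_residues hτ hv), map_add τ,
    h1 _ (Submodule.add_mem_sup hy hz'), add_zero]

end Splitting

/-! ### Sums of differences -/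

section Differences

variable {F : Type*} [Field F] {m r : ℕ}

/-- The sums `Δ_{τ_1}(v_1) + ⋯ + Δ_{τ_r}(v_r)` with all `v_i` in `V`. -/
def coboundaries (τ : Fin r → Aut F m) (V : Submodule F (RatFun F m)) :
    Submodule F (RatFun F m) where
  carrier := {u | ∃ v : Fin r → RatFun F m, (∀ i, v i ∈ V) ∧ u = ∑ i, diff (τ i) (v i)}
  zero_mem' := ⟨0, fun _ => zero_mem _, by simp [diff]⟩
  add_mem' := by
    rintro _ _ ⟨v, hv, rfl⟩ ⟨w, hw, rfl⟩
    refine ⟨v + w, fun i => add_mem (hv i) (hw i), ?_⟩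
    rw [← Finset.sum_add_distrib]
    refine Finset.sum_congr rfl fun i _ => ?_
    simp only [diff, Pi.add_apply, map_add]
    abel
  smul_mem' := by
    rintro c _ ⟨v, hv, rfl⟩
    refine ⟨c • v, fun i => Submodule.smul_mem _ c (hv i), ?_⟩
    simp only [diff, Pi.smul_apply, map_smul, smul_sub, Finset.smul_sum]

theorem isSummable_iff_mem_coboundaries {τ : Fin r → Aut F m} {f : RatFun F m} :
    IsSummable τ f ↔ f ∈ coboundaries τ ⊤ :=
  ⟨fun ⟨g, h⟩ => ⟨g, fun _ => trivial, h⟩, fun ⟨g, _, h⟩ => ⟨g, h⟩⟩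

/-- The identities `Δ_{ρκ} = Δ_ρ κ + Δ_κ` and `Δ_{ρ⁻¹} = -Δ_ρ ρ⁻¹` reduce the differences of all
elements of a group to those of its generators. -/
theorem diff_mem_coboundaries {τ : Fin r → Aut F m} {V : Submodule F (RatFun F m)}
    (hV : ∀ ρ ∈ Subgroup.closure (Set.range τ), ∀ v ∈ V, ρ v ∈ V) {ρ : Aut F m}
    (hρ : ρ ∈ Subgroup.closure (Set.range τ)) {v : RatFun F m} (hv : v ∈ V) :
    diff ρ v ∈ coboundaries τ V := by
  induction hρ using Subgroup.closure_induction generalizing v with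
  | mem ρ hρ =>
    obtain ⟨i, rfl⟩ := hρ
    refine ⟨Pi.single i v, fun k => ?_, ?_⟩
    · by_cases hk : k = i
      · subst hk; simpa using hv
      · simp [hk]
    · rw [Finset.sum_eq_single i]
      · simp
      · intro k _ hk
        simp [diff, hk]
      · simp
  | one => simp [diff]
  | mul ρ κ hρ hκ ihρ ihκ =>
    have : diff (ρ * κ) v = diff ρ (κ v) + diff κ v := by simp [diff]
    rw [this]
    exact add_mem (ihρ (hV κ hκ v hv)) (ihκ hv)
  | inv ρ hρ ih =>
    have : diff ρ⁻¹ v = -diff ρ (ρ⁻¹ v) := by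
      simp only [diff, ← AlgEquiv.mul_apply, mul_inv_cancel, AlgEquiv.one_apply, neg_sub]
    rw [this]
    exact neg_mem (ih (hV _ (inv_mem hρ) v hv))

end Differences

/-! ### The isotropy group -/

section Isotropy

variable {F : Type*} [Field F] {m n : ℕ} {h : n ≤ m} {d : MvPolynomial (Fin m) F}

theorem IsTranslation.mem_isotropy_iff {G : Subgroup (Aut F m)} {τ : Aut F m} {c : Fin m → F}
    (hτ : IsTranslation τ c) (hG : τ ∈ G) : τ ∈ isotropy G d ↔ translate c d = d := by
  rw [isotropy, Subgroup.mem_inf, MulAction.mem_stabilizer_iff, AlgEquiv.smul_def, hτ]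
  exact ⟨fun h => algebraMap_ratFun_injective h.2, fun h => ⟨hG, congrArg _ h⟩⟩

theorem isotropy_le (G : Subgroup (Aut F m)) (d : MvPolynomial (Fin m) F) : isotropy G d ≤ G :=
  inf_le_left

theorem map_algebraMap_of_mem_isotropy {G : Subgroup (Aut F m)} {τ : Aut F m}
    (hτ : τ ∈ isotropy G d) :
    τ (algebraMap _ (RatFun F m) d) = algebraMap _ (RatFun F m) d :=
  hτ.2

variable [NeZero m]

theorem map_mem_residues_of_mem_shiftGroup {τ : Aut F m} (hτ : τ ∈ shiftGroup F h)
    {u : RatFun F m} (hu : u ∈ residues d) : τ u ∈ residues d :=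
  let ⟨_, hc⟩ := exists_isTranslation h hτ
  map_mem_residues hc hu

theorem residue_map_of_mem_isotropy (hd : Prime d) (hdeg : degreeOf 0 d ≠ 0) {τ : Aut F m}
    (hτ : τ ∈ isotropy (shiftGroup F h) d) (u : RatFun F m) :
    residue d hd hdeg (τ u) = τ (residue d hd hdeg u) :=
  let ⟨_, hc⟩ := exists_isTranslation h (isotropy_le _ _ hτ)
  residue_map hd hdeg hc ((hc.mem_isotropy_iff (isotropy_le _ _ hτ)).1 hτ) u

end Isotropy

/-! ### The transfer map -/

section Transfer

variable {F : Type*} [Field F] {m n r : ℕ} [NeZero m] {h : n ≤ m} {d : MvPolynomial (Fin m) F}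
  (hd : Prime d) (hdeg : degreeOf 0 d ≠ 0) {τ : Fin r → Aut F m}
  (hτ : Subgroup.closure (Set.range τ) = isotropy (shiftGroup F h) d) (j : ℕ)

local notation "ι" => algebraMap (MvPolynomial (Fin m) F) (RatFun F m)

/-- The coefficient of order `-j` of `u` at the prime `g d`, moved back to `d` by `g⁻¹` and taken
modulo the differences of residues under the isotropy group of `d`, so that it depends only on the
coset of `g`. -/
noncomputable def transferTerm (u : RatFun F m)
    (q : shiftGroup F h ⧸ (isotropy (shiftGroup F h) d).subgroupOf (shiftGroup F h)) :
    RatFun F m ⧸ coboundaries τ (residues d) :=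
  Quotient.liftOn' q
    (fun g => (coboundaries τ (residues d)).mkQ
      (residue d hd hdeg (ι d ^ j * (g : Aut F m)⁻¹ u))) <| by
    intro a b hab
    rw [QuotientGroup.leftRel_apply, Subgroup.mem_subgroupOf] at hab
    set k : Aut F m := ((a⁻¹ * b : shiftGroup F h) : Aut F m) with hk
    have hb : (b : Aut F m)⁻¹ u = k⁻¹ ((a : Aut F m)⁻¹ u) := by
      rw [← AlgEquiv.mul_apply, hk]
      simp
    have hkd := inv_mem hab
    have hprod : ι d ^ j * k⁻¹ ((a : Aut F m)⁻¹ u) = k⁻¹ (ι d ^ j * (a : Aut F m)⁻¹ u) := by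
      rw [map_mul, map_pow, map_algebraMap_of_mem_isotropy hkd]
    rw [hb, hprod, residue_map_of_mem_isotropy hd hdeg hkd, Submodule.mkQ_apply,
      Submodule.mkQ_apply, eq_comm, Submodule.Quotient.eq]
    refine diff_mem_coboundaries (fun ρ hρ v hv => ?_) (hτ ▸ hkd) (residue_mem hd hdeg _)
    rw [hτ] at hρ
    exact map_mem_residues_of_mem_shiftGroup (isotropy_le _ _ hρ) hv

theorem transferTerm_mk (u : RatFun F m) (g : shiftGroup F h) :
    transferTerm hd hdeg hτ j u (QuotientGroup.mk g) =
      (coboundaries τ (residues d)).mkQ (residue d hd hdeg (ι d ^ j * (g : Aut F m)⁻¹ u)) :=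
  rfl

theorem transferTerm_add (u v : RatFun F m)
    (q : shiftGroup F h ⧸ (isotropy (shiftGroup F h) d).subgroupOf (shiftGroup F h)) :
    transferTerm hd hdeg hτ j (u + v) q =
      transferTerm hd hdeg hτ j u q + transferTerm hd hdeg hτ j v q := by
  induction q using QuotientGroup.induction_on with
  | H g => simp only [transferTerm_mk, map_add, mul_add]

theorem transferTerm_smul (g : shiftGroup F h) (u : RatFun F m)
    (q : shiftGroup F h ⧸ (isotropy (shiftGroup F h) d).subgroupOf (shiftGroup F h)) :
    transferTerm hd hdeg hτ j ((g : Aut F m) u) q = transferTerm hd hdeg hτ j u (g⁻¹ • q) := by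
  induction q using QuotientGroup.induction_on with
  | H k =>
    rw [MulAction.Quotient.smul_coe, transferTerm_mk, transferTerm_mk, ← AlgEquiv.mul_apply]
    simp

variable {j}

theorem transferTerm_mk_eq_zero (hj : 1 ≤ j) {u : RatFun F m} {α β : MvPolynomial (Fin m) F}
    (hu : u * ι β = ι α) {g : shiftGroup F h} {c : Fin m → F} (hc : IsTranslation (g : Aut F m) c)
    (hβ : ¬d ∣ translate (-c) β) : transferTerm hd hdeg hτ j u (QuotientGroup.mk g) = 0 := by
  obtain ⟨j, rfl⟩ := Nat.exists_eq_add_of_le' hj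
  rw [transferTerm_mk, residue_eq_zero_of_mem_vanishingAt, map_zero]
  refine ⟨_, hβ, d ^ j * translate (-c) α, ?_⟩
  rw [← hc.inv, mul_assoc, ← map_mul, hu, hc.inv]
  simp only [map_mul, map_pow, pow_succ]
  ring

/-- Only finitely many translates of `d` divide the denominator of `u`. -/
theorem finite_support_transferTerm (hj : 1 ≤ j) (u : RatFun F m) :
    (transferTerm hd hdeg hτ j u).HasFiniteSupport := by
  classical
  obtain ⟨α, β, hβ, rfl⟩ := IsFractionRing.div_surjective (A := MvPolynomial (Fin m) F) u
  have hβ0 := nonZeroDivisors.ne_zero hβ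
  have hu : ι α / ι β * ι β = ι α :=
    div_mul_cancel₀ _ ((map_ne_zero_iff _ algebraMap_ratFun_injective).2 hβ0)
  choose c hc using fun g : shiftGroup F h => exists_isTranslation h g.2
  let key := fun q : shiftGroup F h ⧸
      (isotropy (shiftGroup F h) d).subgroupOf (shiftGroup F h) =>
    Associates.mk (translate (c q.out) d)
  refine Set.Finite.of_finite_image (f := key) (Set.Finite.subset
    ((UniqueFactorizationMonoid.factors β).map Associates.mk).toFinset.finite_toSet ?_) ?_
  · rintro _ ⟨q, hq, rfl⟩
    have hdvd : translate (c q.out) d ∣ β := by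
      by_contra hndvd
      refine hq ?_
      rw [← QuotientGroup.out_eq' q]
      refine transferTerm_mk_eq_zero hd hdeg hτ hj hu (hc _) fun hdvd => hndvd ?_
      have := map_dvd (translate (c q.out)) hdvd
      rwa [← translate_add_apply, add_neg_cancel, translate_zero_apply] at this
    obtain ⟨p, hp, hpq⟩ := UniqueFactorizationMonoid.exists_mem_factors_of_dvd hβ0
      ((MulEquiv.irreducible_iff (translate (c q.out))).2 hd.irreducible) hdvd
    exact Multiset.mem_toFinset.2 <| Multiset.mem_map.2
      ⟨p, hp, (Associates.mk_eq_mk_iff_associated.2 hpq).symm⟩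
  · intro q _ q' _ hqq
    have hassoc : Associated (translate (c q.out) d) (translate (c q'.out) d) :=
      Associates.mk_eq_mk_iff_associated.1 hqq
    have hassoc' := (hassoc.map (translate (-c q.out))).symm
    rw [← translate_add_apply, ← translate_add_apply, neg_add_cancel, translate_zero_apply]
      at hassoc'
    rw [← QuotientGroup.out_eq' q, ← QuotientGroup.out_eq' q', QuotientGroup.eq,
      Subgroup.mem_subgroupOf]
    exact (((hc q.out).inv.mul (hc q'.out)).mem_isotropy_iff
      (mul_mem (inv_mem q.out.2) q'.out.2)).2 (translate_eq_of_associated hassoc')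

/-- The sum of the coefficients of order `-j` along the orbit of `d`, moved back to `d`. -/
noncomputable def transfer (hj : 1 ≤ j) :
    RatFun F m →+ RatFun F m ⧸ coboundaries τ (residues d) :=
  AddMonoidHom.mk' (fun u => ∑ᶠ q, transferTerm hd hdeg hτ j u q) fun u v => by
    rw [← finsum_add_distrib (finite_support_transferTerm hd hdeg hτ hj u)
      (finite_support_transferTerm hd hdeg hτ hj v)]
    exact finsum_congr fun q => transferTerm_add hd hdeg hτ j u v q

theorem transfer_diff (hj : 1 ≤ j) {g : Aut F m} (hg : g ∈ shiftGroup F h) (u : RatFun F m) :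
    transfer hd hdeg hτ hj (diff g u) = 0 := by
  rw [diff, map_sub, sub_eq_zero]
  calc ∑ᶠ q, transferTerm hd hdeg hτ j (g u) q
      = ∑ᶠ q, transferTerm hd hdeg hτ j u
          (MulAction.toPerm ((⟨g, hg⟩ : shiftGroup F h)⁻¹) q) :=
        finsum_congr fun q => transferTerm_smul hd hdeg hτ j ⟨g, hg⟩ u q
    _ = ∑ᶠ q, transferTerm hd hdeg hτ j u q := finsum_comp_equiv _

theorem transfer_div_pow (hj : 1 ≤ j) {a : RatFun F m} (ha : a ∈ residues d) :
    transfer hd hdeg hτ hj (a / ι d ^ j) = (coboundaries τ (residues d)).mkQ a := by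
  have hd0 : ι d ≠ 0 := (map_ne_zero_iff _ algebraMap_ratFun_injective).2 hd.ne_zero
  have h1 : transfer hd hdeg hτ hj (a / ι d ^ j) =
      transferTerm hd hdeg hτ j (a / ι d ^ j) (QuotientGroup.mk 1) := by
    refine finsum_eq_single _ _ fun q => ?_
    induction q using QuotientGroup.induction_on with
    | H g =>
      intro hg
      obtain ⟨c, hc⟩ := exists_isTranslation h g.2
      obtain ⟨b, hb, -, s, -, hs⟩ := ha
      refine transferTerm_mk_eq_zero hd hdeg hτ hj (α := s) (β := b * d ^ j) ?_ hc ?_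
      · rw [map_mul, map_pow, mul_left_comm, div_mul_cancel₀ _ (pow_ne_zero _ hd0), mul_comm, hs]
      · rw [map_mul, map_pow]
        intro hdvd
        rcases hd.dvd_or_dvd hdvd with hdvd | hdvd
        · exact not_dvd_of_mem_hatDenominators hdeg (translate_mem_hatDenominators _ hb) hdvd
        · have hirr := (MulEquiv.irreducible_iff (translate (-c))).2 hd.irreducible
          have hassoc := (hd.irreducible.associated_of_dvd hirr (hd.dvd_of_dvd_pow hdvd)).symm
          refine hg (QuotientGroup.eq.2 (Subgroup.mem_subgroupOf.2 ?_))
          rw [mul_one]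
          exact (hc.inv.mem_isotropy_iff (inv_mem g.2)).2 (translate_eq_of_associated hassoc)
  rw [h1, transferTerm_mk, OneMemClass.coe_one, inv_one, AlgEquiv.one_apply,
    mul_div_cancel₀ _ (pow_ne_zero _ hd0), residue_of_mem hd hdeg ha]

/-- The criterion in terms of residues instead of univariate polynomials. -/
theorem isSummable_div_pow_iff (hd : Prime d) (hdeg : degreeOf 0 d ≠ 0)
    (hτ : Subgroup.closure (Set.range τ) = isotropy (shiftGroup F h) d) (hj : 1 ≤ j)
    {a : RatFun F m} (ha : a ∈ residues d) :
    IsSummable (firstShifts F h) (a / ι d ^ j) ↔ a ∈ coboundaries τ (residues d) := by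
  constructor
  · rintro ⟨g, hg⟩
    rw [← Submodule.Quotient.mk_eq_zero, ← Submodule.mkQ_apply, ← transfer_div_pow hd hdeg hτ hj ha,
      hg, map_sum]
    exact Finset.sum_eq_zero fun i _ =>
      transfer_diff hd hdeg hτ hj (Subgroup.subset_closure ⟨i, rfl⟩) _
  · rintro ⟨v, -, rfl⟩
    rw [isSummable_iff_mem_coboundaries, Finset.sum_div]
    refine sum_mem fun i _ => ?_
    have hi : τ i ∈ isotropy (shiftGroup F h) d := hτ ▸ Subgroup.subset_closure ⟨i, rfl⟩
    have : diff (τ i) (v i) / ι d ^ j = diff (τ i) (v i / ι d ^ j) := by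
      rw [diff, diff, map_div₀, map_pow, map_algebraMap_of_mem_isotropy hi, sub_div]
    rw [this]
    exact diff_mem_coboundaries (fun _ _ _ _ => Submodule.mem_top) (isotropy_le _ _ hi)
      Submodule.mem_top

end Transfer

/-! ### Polynomials in the first variable over the field of the other variables -/

section FirstVariablePolynomials

variable {F : Type*} [Field F] {m : ℕ} [NeZero m]

local notation "ι" => algebraMap (MvPolynomial (Fin m) F) (RatFun F m)

theorem var_mem_hatField {i : Fin m} (hi : i ≠ 0) : var F m i ∈ hatField F m :=
  IntermediateField.subset_adjoin _ _ ⟨i, hi, rfl⟩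

open Classical in
/-- A polynomial in all variables, read as a polynomial in `x_1` over the field of the others. -/
noncomputable def toPoly : MvPolynomial (Fin m) F →ₐ[F] (hatField F m)[X] :=
  aeval fun i => if hi : i = 0 then Polynomial.X else Polynomial.C ⟨var F m i, var_mem_hatField hi⟩

theorem ofPoly_C (c : hatField F m) : ofPoly (Polynomial.C c) = (c : RatFun F m) :=
  Polynomial.aeval_C _ _

theorem ofPoly_toPoly (p : MvPolynomial (Fin m) F) : ofPoly (toPoly p) = ι p := by
  induction p using MvPolynomial.induction_on with
  | C c =>
    rw [← algebraMap_eq, AlgHom.commutes, ← IsScalarTower.algebraMap_apply]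
    exact ofPoly_C (algebraMap F (hatField F m) c)
  | add p q hp hq => rw [map_add, map_add, map_add, hp, hq]
  | mul_X p i hp =>
    rw [map_mul, map_mul, map_mul, hp]
    congr 1
    rw [toPoly, aeval_X]
    split_ifs with hi
    · subst hi
      exact Polynomial.aeval_X _
    · exact ofPoly_C _

theorem natDegree_toPoly_le (p : MvPolynomial (Fin m) F) :
    (toPoly p).natDegree ≤ degreeOf 0 p := by
  classical
  rw [toPoly, aeval_def, eval₂_eq']
  refine Polynomial.natDegree_sum_le_of_forall_le _ _ fun s hs => ?_
  refine (Polynomial.natDegree_C_mul_le _ _).trans ?_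
  refine (Polynomial.natDegree_prod_le _ _).trans (le_trans ?_ (degreeOf_le_iff.1 le_rfl s hs))
  refine (Finset.sum_le_sum fun i _ => (?_ : _ ≤ if 0 = i then s i else 0)).trans (by simp)
  refine Polynomial.natDegree_pow_le.trans ?_
  by_cases hi : i = 0
  · subst hi; simp
  · simp [hi]

theorem exists_hatField_eq {b : MvPolynomial (Fin m) F} (hb : b ∈ hatDenominators F m) :
    ∃ c : hatField F m, (c : RatFun F m) = ι b := by
  have h := Polynomial.eq_C_of_natDegree_le_zero ((natDegree_toPoly_le b).trans hb.2.le)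
  exact ⟨_, by rw [← ofPoly_C, ← h, ofPoly_toPoly]⟩

/-- The elements of the field of the variables other than `x_1` are the quotients of polynomials
free of `x_1`. -/
theorem coe_mem_boundedFractions (c : hatField F m) :
    (c : RatFun F m) ∈ boundedFractions (hatDenominators F m) 1 := by
  have hι : ∀ {p : MvPolynomial (Fin m) F}, p ≠ 0 → ι p ≠ 0 :=
    (map_ne_zero_iff _ algebraMap_ratFun_injective).2
  have key : ∀ p : MvPolynomial (Fin m) F, degreeOf 0 p = 0 →
      ι p ∈ boundedFractions (hatDenominators F m) 1 := fun p hp =>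
    ⟨1, one_mem _, one_ne_zero, p, by
      by_cases h0 : p = 0
      · rw [h0]; exact zero_mem _
      · rw [mem_degLT_iff_of_ne_zero h0, hp]; exact Nat.succ_pos _, by simp⟩
  obtain ⟨c, hc⟩ := c
  induction hc using IntermediateField.adjoin_induction with
  | mem x hx =>
    obtain ⟨i, hi, rfl⟩ := hx
    exact key _ (by classical rw [degreeOf_X, if_neg (Ne.symm hi)])
  | algebraMap x => exact key (C x) (degreeOf_C _ _)
  | add x y _ _ hx hy => exact add_mem hx hy
  | inv x _ hx =>
    obtain ⟨b, hb, hb0, s, hs, h⟩ := hx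
    by_cases h0 : s = 0
    · have : x = 0 := by
        rw [h0, map_zero] at h
        exact (mul_eq_zero.1 h).resolve_right (hι hb0)
      simp [this]
    have hs' : degreeOf 0 s = 0 := by
      have := (mem_degLT_iff_of_ne_zero h0).1 hs
      rw [hb.2] at this
      omega
    refine ⟨s, ⟨h0, hs'⟩, h0, b, ?_, ?_⟩
    · rw [mem_degLT_iff_of_ne_zero hb0, hb.2]; exact Nat.succ_pos _
    · have hx : x ≠ 0 := by
        rintro rfl
        exact hι h0 (by rw [← h, zero_mul])
      rw [← h, inv_mul_cancel_left₀ hx]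
  | mul x y _ _ hx hy =>
    obtain ⟨b, hb, hb0, s, hs, h⟩ := hx
    obtain ⟨c, hc, hc0, t, ht, h'⟩ := hy
    refine ⟨b * c, mul_mem hb hc, mul_ne_zero hb0 hc0, s * t, mul_mem_degLT hs ?_, ?_⟩
    · rw [degreeOf_mul_eq hb0 hc0, hb.2, hc.2]
      by_cases h0 : t = 0
      · simp [h0]
      · have := (mem_degLT_iff_of_ne_zero h0).1 ht
        rw [hc.2] at this
        omega
    · simp only [map_mul]
      rw [← h, ← h']
      ring

theorem mem_boundedFractions_iff {k : ℕ} (hk : 0 < k) {u : RatFun F m} :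
    u ∈ boundedFractions (hatDenominators F m) k ↔
      ∃ p : (hatField F m)[X], p.degree < (k : WithBot ℕ) ∧ ofPoly p = u := by
  constructor
  · rintro ⟨b, hb, hb0, s, hs, h⟩
    obtain ⟨c, hc⟩ := exists_hatField_eq hb
    refine ⟨Polynomial.C c⁻¹ * toPoly s, ?_, ?_⟩
    · have hs' : degreeOf 0 s < k := by
        by_cases h0 : s = 0
        · simpa [h0] using hk
        · rw [hb.2, zero_add] at hs
          exact (mem_degLT_iff_of_ne_zero h0).1 hs
      refine Polynomial.degree_le_natDegree.trans_lt (Nat.cast_lt.2 ?_)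
      exact (Polynomial.natDegree_C_mul_le _ _).trans_lt ((natDegree_toPoly_le s).trans_lt hs')
    · rw [map_mul, ofPoly_C, ofPoly_toPoly, ← h, ← hc]
      have hc0 : (c : RatFun F m) ≠ 0 :=
        hc ▸ (map_ne_zero_iff _ algebraMap_ratFun_injective).2 hb0
      rw [IntermediateField.coe_inv]
      field_simp
  · rintro ⟨p, hp, rfl⟩
    rw [ofPoly, Polynomial.aeval_eq_sum_range]
    refine sum_mem fun i hi => ?_
    by_cases hpi : p.coeff i = 0
    · rw [hpi, zero_smul]; exact zero_mem _
    have hik : i < k := by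
      have := (Polynomial.le_degree_of_ne_zero hpi).trans_lt hp
      exact_mod_cast this
    obtain ⟨b, hb, hb0, s, hs, h⟩ := coe_mem_boundedFractions (p.coeff i)
    refine ⟨b, hb, hb0, s * X 0 ^ i, mul_mem_degLT hs ?_, ?_⟩
    · rw [degreeOf_X_self_pow]; omega
    · rw [map_mul, ← h, map_pow, Algebra.smul_def]
      change (p.coeff i : RatFun F m) * ι (X 0) ^ i * _ = _
      ring

end FirstVariablePolynomials

end RationalSummation

open RationalSummation in
theorem theorem2 {F : Type*} [Field F] [CharZero F] {m n : ℕ} [NeZero m]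
    (hn : 1 ≤ n) (hnm : n ≤ m)
    (d : MvPolynomial (Fin m) F) (hd : Irreducible d)
    (j : ℕ) (hj : 1 ≤ j)
    (a : (hatField F m)[X]) (ha : a.degree < (d.degreeOf 0 : WithBot ℕ))
    {r : ℕ} (τ : Fin r → Aut F m) (hτ : IsGroupBasis (isotropy (shiftGroup F hnm) d) τ) :
    IsSummable (firstShifts F hnm)
        (ofPoly a / algebraMap (MvPolynomial (Fin m) F) (RatFun F m) d ^ j) ↔
      ∃ b : Fin r → (hatField F m)[X],
        (∀ i, (b i).degree < (d.degreeOf 0 : WithBot ℕ)) ∧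
          ofPoly a = ∑ i, diff (τ i) (ofPoly (b i)) := by
  by_cases hdeg : d.degreeOf 0 = 0
  · -- Here `deg a < 0` forces `a = 0`, and both sides hold with all summands zero.
    have ha0 : a = 0 := by
      rw [hdeg] at ha
      exact Polynomial.degree_eq_bot.1 (Nat.WithBot.lt_zero_iff.1 ha)
    refine ⟨fun _ => ⟨0, fun i => ?_, ?_⟩, fun _ => ⟨0, ?_⟩⟩
    · simp
    · simp [ha0, diff]
    · simp [ha0, diff]
  · have hmem := fun u => mem_boundedFractions_iff (F := F) (m := m)
      (Nat.pos_of_ne_zero hdeg) (u := u)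
    rw [isSummable_div_pow_iff hd.prime hdeg hτ.closure_eq hj ((hmem _).2 ⟨a, ha, rfl⟩)]
    constructor
    · rintro ⟨v, hv, h⟩
      choose b hb hbv using fun i => (hmem _).1 (hv i)
      exact ⟨b, hb, by simp only [hbv, h]⟩
    · rintro ⟨b, hb, h⟩
      exact ⟨fun i => ofPoly (b i), fun i => (hmem _).2 ⟨b i, hb i, rfl⟩, h⟩
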